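/- Let $n,d\ge 1$. A (possibly adaptive) single-copy algorithm receives $T$ copies of an unknown state $\rho$ on $(\mathbb C^d)^{\otimes n}$ one at a time. It applies to the $t$-th copy a discrete POVM on $(\mathbb C^d)^{\otimes n}$ that may depend on the outcomes of the first $t-1$ measurements, and after the $T$-th measurement it outputs one of two answers, with a probability that may depend on the whole outcome string. Consider the task of distinguishing - $H_0$: $\rho=\mathbb I/d^n$ is the maximally mixed state, from - $H_1$: $\rho=|\psi\rangle\langle\psi|$ with $|\psi\rangle=|v_1\rangle\otimes\cdots\otimes|v_n\rangle$, where $|v_1\rangle,\dots,|v_n\rangle\in\mathbb C^d$ are independent Haar-random pure states; $|\psi\rangle$ is drawn once, and all $T$ copies are in this state. Then there are absolute constants $c,C>0$ such that for all $n,d\ge1$ and $T\ge 0$ the following hold. 1. Every such algorithm that answers correctly with probability at least $2/3$ (where $H_0$ and $H_1$ each have prior probability $1/2$) satisfies $T\ge c\sqrt{d/n}$. 2. For every such algorithm, the bias $\bigl|\Pr[\text{answer }H_1\mid H_1]-\Pr[\text{answer }H_1\mid H_0]\bigr|$ is at most $C\,nT^2/d$. -/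

import Mathlib

open MeasureTheory
open scoped Matrix ComplexOrder

universe u

noncomputable section

namespace SingleCopy

/-! ### Haar measure on the unitary group -/

instance unitaryGroupCompactSpace (d : ℕ) :
    CompactSpace (Matrix.unitaryGroup (Fin d) ℂ) := by
  refine isCompact_iff_compactSpace.mp
    (?_ : IsCompact (Matrix.unitaryGroup (Fin d) ℂ : Set (Matrix (Fin d) (Fin d) ℂ)))
  have hK : IsCompact (Set.univ.pi fun _ : Fin d => Set.univ.pi fun _ : Fin d =>
      Metric.closedBall (0 : ℂ) 1) :=
    isCompact_univ_pi fun _ => isCompact_univ_pi fun _ => isCompact_closedBall _ _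
  refine IsCompact.of_isClosed_subset hK ?_ ?_
  · have h : ((Matrix.unitaryGroup (Fin d) ℂ : Set (Matrix (Fin d) (Fin d) ℂ))) =
        {A | star A * A = 1} ∩ {A | A * star A = 1} := by
      ext A
      exact Unitary.mem_iff
    rw [h]
    exact (isClosed_eq (continuous_star.mul continuous_id) continuous_const).inter
      (isClosed_eq (continuous_id.mul continuous_star) continuous_const)
  · intro A hA i _ j _
    rw [mem_closedBall_zero_iff]
    exact entry_norm_bound_of_unitary hA i j

instance unitaryGroupMeasurableSpace (d : ℕ) :
    MeasurableSpace (Matrix.unitaryGroup (Fin d) ℂ) := borel _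

instance unitaryGroupBorelSpace (d : ℕ) :
    BorelSpace (Matrix.unitaryGroup (Fin d) ℂ) := ⟨rfl⟩

/-- The Haar probability measure on the unitary group `U(d)`. -/
def haarUnitary (d : ℕ) : Measure (Matrix.unitaryGroup (Fin d) ℂ) :=
  Measure.haarMeasure ⊤

instance haarUnitaryIsProbabilityMeasure (d : ℕ) : IsProbabilityMeasure (haarUnitary d) :=
  ⟨Measure.haarMeasure_self (K₀ := (⊤ : TopologicalSpace.PositiveCompacts _))⟩

/-! ### States

Vectors of `(ℂ^d)^{⊗ n}` are written in the computational basis, which is indexed by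
`Fin n → Fin d`; operators are matrices with this index set. -/

/-- The density matrix `|ψ⟩⟨ψ|`. -/
def pureDensity {ι : Type*} (ψ : ι → ℂ) : Matrix ι ι ℂ :=
  Matrix.vecMulVec ψ (star ψ)

/-- The product vector `v₁ ⊗ ⋯ ⊗ vₙ`. -/
def productVector {n d : ℕ} (v : Fin n → Fin d → ℂ) : (Fin n → Fin d) → ℂ :=
  fun i => ∏ k, v k (i k)

/-- The maximally mixed state on `(ℂ^d)^{⊗ n}`. -/
def maximallyMixed (n d : ℕ) : Matrix (Fin n → Fin d) (Fin n → Fin d) ℂ :=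
  ((d : ℂ) ^ n)⁻¹ • 1

/-- The density matrix of `(U₁|φ⟩) ⊗ ⋯ ⊗ (Uₙ|φ⟩)`. -/
def rotatedProductState {n d : ℕ} (φ : EuclideanSpace ℂ (Fin d))
    (U : Fin n → Matrix.unitaryGroup (Fin d) ℂ) :
    Matrix (Fin n → Fin d) (Fin n → Fin d) ℂ :=
  pureDensity (productVector fun k => (U k : Matrix (Fin d) (Fin d) ℂ) *ᵥ φ.ofLp)

/-! ### Single-copy measurements -/

/-- A discrete POVM with outcomes in `K`. The outcome set may be infinite, and effects may be
zero, so that POVMs with fewer outcomes are included. -/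
structure POVM (ι : Type*) [Fintype ι] [DecidableEq ι] (K : Type u) where
  /-- The effect of an outcome. -/
  effect : K → Matrix ι ι ℂ
  posSemidef : ∀ k, (effect k).PosSemidef
  hasSum_one : HasSum effect 1

/-- An adaptive algorithm which measures `T` copies of an `n`-qudit state one at a time.
The POVM applied to the copy `t` may depend on all earlier outcomes. After the last
measurement the algorithm answers "Haar-random product state" (it accepts) with a probability
which depends on the whole outcome string, and answers "maximally mixed" otherwise. -/
structure Algorithm (n d T : ℕ) (K : Type u) where
  /-- The measurement of copy `t`, given the outcomes of the copies before it. -/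
  measurement : (t : Fin T) → (Fin (t : ℕ) → K) → POVM (Fin n → Fin d) K
  /-- The probability of accepting, given all outcomes. -/
  decision : (Fin T → K) → ℝ
  decision_nonneg : ∀ l, 0 ≤ decision l
  decision_le_one : ∀ l, decision l ≤ 1

namespace Algorithm

variable {n d T : ℕ} {K : Type u}

/-- The probability of the outcome string `l` when every copy is in the state `ρ`. -/
def outcomeProb (A : Algorithm n d T K) (ρ : Matrix (Fin n → Fin d) (Fin n → Fin d) ℂ)
    (l : Fin T → K) : ℝ :=
  ∏ t : Fin T,
    (Matrix.trace
      (ρ * (A.measurement t fun s => l (Fin.castLE t.isLt.le s)).effect (l t))).re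

/-- The probability of the outcome string `l` when the state is maximally mixed. -/
def mixedOutcomeProb (A : Algorithm n d T K) (l : Fin T → K) : ℝ :=
  A.outcomeProb (maximallyMixed n d) l

/-- The probability of the outcome string `l` when a product of `n` independent Haar-random
pure states is drawn once and all `T` copies are in that state. -/
def haarProductOutcomeProb (A : Algorithm n d T K) (φ : EuclideanSpace ℂ (Fin d))
    (l : Fin T → K) : ℝ :=
  ∫ U : Fin n → Matrix.unitaryGroup (Fin d) ℂ, A.outcomeProb (rotatedProductState φ U) l
    ∂(Measure.pi fun _ => haarUnitary d)

/-- The probability of accepting when the outcome strings have the distribution `p`. -/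
def acceptProb (A : Algorithm n d T K) (p : (Fin T → K) → ℝ) : ℝ :=
  ∑' l, A.decision l * p l

/-- The difference of the probabilities of accepting under the two hypotheses. -/
def bias (A : Algorithm n d T K) (φ : EuclideanSpace ℂ (Fin d)) : ℝ :=
  |A.acceptProb (A.haarProductOutcomeProb φ) - A.acceptProb A.mixedOutcomeProb|

/-- The probability of a correct answer when both hypotheses have prior probability `1/2`. -/
def successProb (A : Algorithm n d T K) (φ : EuclideanSpace ℂ (Fin d)) : ℝ :=
  (1 / 2) * A.acceptProb (A.haarProductOutcomeProb φ) +
    (1 / 2) * (1 - A.acceptProb A.mixedOutcomeProb)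

end Algorithm

end SingleCopy

end

/-! Everything rests on a pointwise, one-sided likelihood-ratio bound: each outcome string `l`
satisfies `p₁ l ≥ r * p₀ l` with `r = (d ^ T / d.ascFactorial T) ^ n`, where `p₀` and `p₁` are its
probabilities under the two hypotheses. Such a bound limits the bias of any test to `1 - r`
(`abs_tsum_sub_tsum_le`), and Bernoulli's inequality gives `1 - r ≤ n * T ^ 2 / d`
(`one_sub_le_div_pow`). Adaptivity costs nothing, because a fixed string determines the effects that
were measured.

For a fixed string with effects `M t`, the claim is that the Haar average of `∏ t, tr (ρ * M t)` is
at least `∏ t, tr (M t)` divided by `d.ascFactorial T ^ n` (`prod_trace_le_integral`). Splitting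
each effect into rank-one terms reduces it to `∏ t, |f t (v₁ ⊗ ⋯ ⊗ vₙ)|²` for multilinear forms `f
t`. Homogeneity permits replacing the unit vectors by Gaussian vectors: the radial parts contribute
the moment `d.ascFactorial T` once per tensor factor (`integral_mul_gaussWeight_eq`).

The Gaussian average is the squared Fischer norm of the polynomial `∏ t, f t`, so what remains is
Bombieri's inequality: the squared norm of the product is at least the product of the squared norms.
In the Fischer inner product, multiplication by a variable is adjoint to differentiation. Commuting
these operators past each other, mode by mode, leaves the product of squared norms plus terms that
are again nonnegative (`modeForm_succ`, `modeForm_nonneg`). -/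

namespace SingleCopy

/-! ### Bombieri's inequality from the commutation relations -/

section Fischer

open MvPolynomial ComplexConjugate

variable {κ : Type} {d : ℕ}

/-- The monomial `∏ₖ X (c k, i k)` which picks one variable in each of the modes `c k`. -/
noncomputable def modeMonomial {m : ℕ} (c : Fin m → κ) (i : Fin m → Fin d) :
    MvPolynomial (κ × Fin d) ℂ :=
  ∏ k, X (c k, i k)

lemma modeMonomial_cons {m : ℕ} (c : Fin (m + 1) → κ) (a : Fin d) (i : Fin m → Fin d) :
    modeMonomial c (Fin.cons a i : Fin (m + 1) → Fin d) =
      X (c 0, a) * modeMonomial (fun k => c k.succ) i := by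
  simp [modeMonomial, Fin.prod_univ_succ]

lemma pderiv_modeMonomial_of_notMem {m : ℕ} (c : Fin m → κ) (i : Fin m → Fin d)
    (k₀ : κ) (a : Fin d) (h : ∀ k, c k ≠ k₀) : pderiv (k₀, a) (modeMonomial c i) = 0 := by
  classical
  unfold modeMonomial
  induction (Finset.univ : Finset (Fin m)) using Finset.induction_on with
  | empty => simp
  | insert k s hk ih =>
    rw [Finset.prod_insert hk, Derivation.leibniz, ih, pderiv_X_of_ne]
    · simp
    · intro h'
      exact h k (congrArg Prod.fst h')

/-- The canonical commutation relation between multiplication by a variable and its adjoint. -/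
lemma form_X_mul_modeMonomial [DecidableEq κ]
    (B : MvPolynomial (κ × Fin d) ℂ →ₗ⋆[ℂ] MvPolynomial (κ × Fin d) ℂ →ₗ[ℂ] ℂ)
    (hadj : ∀ s p q, B (X s * p) q = B p (pderiv s q))
    (hadj' : ∀ s p q, B p (X s * q) = B (pderiv s p) q)
    {m : ℕ} (c : Fin m → κ) (k₀ : κ) (h : ∀ k, c k ≠ k₀) (a b : Fin d) (i j : Fin m → Fin d)
    (u v : MvPolynomial (κ × Fin d) ℂ) :
    B (X (k₀, a) * modeMonomial c i * u) (X (k₀, b) * modeMonomial c j * v) =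
      (if a = b then B (modeMonomial c i * u) (modeMonomial c j * v) else 0) +
      B (modeMonomial c i * pderiv (k₀, b) u) (modeMonomial c j * pderiv (k₀, a) v) := by
  have h1 : pderiv (k₀, a) (X (k₀, b) * modeMonomial c j * v) =
      (if a = b then modeMonomial c j * v else 0) +
        X (k₀, b) * (modeMonomial c j * pderiv (k₀, a) v) := by
    rw [mul_assoc, Derivation.leibniz, Derivation.leibniz,
      pderiv_modeMonomial_of_notMem c j k₀ a h]
    by_cases hab : a = b
    · subst hab
      simp [add_comm]
    · rw [pderiv_X_of_ne (fun h' => hab (congrArg Prod.snd h').symm)]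
      simp [hab]
  have h2 : pderiv (k₀, b) (modeMonomial c i * u) = modeMonomial c i * pderiv (k₀, b) u := by
    rw [Derivation.leibniz, pderiv_modeMonomial_of_notMem c i k₀ b h]
    simp
  rw [mul_assoc, hadj, h1, map_add, hadj', h2]
  split_ifs <;> simp

/-- The sesquilinear expression to which moving the creation operators of the modes `c` past
each other leads. -/
noncomputable def modeForm
    (B : MvPolynomial (κ × Fin d) ℂ →ₗ⋆[ℂ] MvPolynomial (κ × Fin d) ℂ →ₗ[ℂ] ℂ)
    {m : ℕ} (c : Fin m → κ) {E : Type} [Fintype E] (f : E → (Fin m → Fin d) → ℂ)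
    (g : E → MvPolynomial (κ × Fin d) ℂ) : ℂ :=
  ∑ e, ∑ e', ∑ i, ∑ j, conj (f e i) * f e' j *
    B (modeMonomial c i * g e') (modeMonomial c j * g e)

lemma sum_fin_succ_fun {m : ℕ} {M : Type*} [AddCommMonoid M] (F : (Fin (m + 1) → Fin d) → M) :
    ∑ i, F i = ∑ a : Fin d, ∑ i : Fin m → Fin d, F (Fin.cons a i) := by
  rw [← Fintype.sum_prod_type']
  exact (Fintype.sum_equiv (Fin.consEquiv fun _ => Fin d) _ _ fun _ => rfl).symm

/-- The commutation relation in mode `c 0` yields a contracted term, where the two indices agree,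
and a term with two derivatives. The derivatives land crosswise: the index summed with `f e'`
differentiates `g e'`, which stands in the other slot of `B` from its own monomial. The crossed
pairing of `e` and `e'` in `modeForm` matches this, so the derivative term is again a `modeForm`,
over the family `E × Fin d`. Injectivity of `c` keeps these derivatives from acting on the remaining
modes. -/
lemma modeForm_succ [DecidableEq κ]
    (B : MvPolynomial (κ × Fin d) ℂ →ₗ⋆[ℂ] MvPolynomial (κ × Fin d) ℂ →ₗ[ℂ] ℂ)
    (hadj : ∀ s p q, B (X s * p) q = B p (pderiv s q))
    (hadj' : ∀ s p q, B p (X s * q) = B (pderiv s p) q)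
    {m : ℕ} (c : Fin (m + 1) → κ) (hc : Function.Injective c) {E : Type} [Fintype E]
    (f : E → (Fin (m + 1) → Fin d) → ℂ) (g : E → MvPolynomial (κ × Fin d) ℂ) :
    modeForm B c f g =
      (∑ a, modeForm B (fun k => c k.succ) (fun e i => f e (Fin.cons a i)) g) +
      modeForm B (fun k => c k.succ) (fun (e : E × Fin d) i => f e.1 (Fin.cons e.2 i))
        (fun e => pderiv (c 0, e.2) (g e.1)) := by
  have h : ∀ k : Fin m, c k.succ ≠ c 0 := fun k hk => Fin.succ_ne_zero k (hc hk)
  have hL : modeForm B c f g = ∑ e, ∑ e', ∑ a, ∑ b, ∑ i : Fin m → Fin d, ∑ j : Fin m → Fin d,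
      conj (f e (Fin.cons a i)) * f e' (Fin.cons b j) *
        ((if a = b then B (modeMonomial (fun k => c k.succ) i * g e')
            (modeMonomial (fun k => c k.succ) j * g e) else 0) +
          B (modeMonomial (fun k => c k.succ) i * pderiv (c 0, b) (g e'))
            (modeMonomial (fun k => c k.succ) j * pderiv (c 0, a) (g e))) := by
    unfold modeForm
    refine Finset.sum_congr rfl fun e _ => Finset.sum_congr rfl fun e' _ => ?_
    rw [sum_fin_succ_fun]
    refine Finset.sum_congr rfl fun a _ => ?_
    simp_rw [sum_fin_succ_fun (m := m), modeMonomial_cons]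
    rw [Finset.sum_comm]
    refine Finset.sum_congr rfl fun b _ => Finset.sum_congr rfl fun i _ =>
      Finset.sum_congr rfl fun j _ => ?_
    rw [form_X_mul_modeMonomial B hadj hadj' _ _ h]
  rw [hL]
  simp_rw [mul_add, Finset.sum_add_distrib]
  congr 1
  · unfold modeForm
    rw [Finset.sum_comm (s := (Finset.univ : Finset (Fin d)))]
    refine Finset.sum_congr rfl fun e _ => ?_
    rw [Finset.sum_comm (s := (Finset.univ : Finset (Fin d)))]
    refine Finset.sum_congr rfl fun e' _ => Finset.sum_congr rfl fun a _ => ?_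
    rw [Finset.sum_eq_single a]
    · simp
    · intro b _ hb
      simp [hb.symm]
    · simp
  · unfold modeForm
    rw [Fintype.sum_prod_type]
    refine Finset.sum_congr rfl fun e _ => ?_
    rw [Finset.sum_comm]
    refine Finset.sum_congr rfl fun a _ => ?_
    rw [Fintype.sum_prod_type]

/-- Both terms of the recursion have the same shape with one mode fewer, so induction ends at no
modes, where the expression is `B h h` for a single polynomial `h`. The arbitrary family `E` is
needed because the recursion enlarges it. -/
lemma modeForm_nonneg [DecidableEq κ]
    (B : MvPolynomial (κ × Fin d) ℂ →ₗ⋆[ℂ] MvPolynomial (κ × Fin d) ℂ →ₗ[ℂ] ℂ)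
    (hpos : ∀ p, 0 ≤ (B p p).re)
    (hadj : ∀ s p q, B (X s * p) q = B p (pderiv s q))
    (hadj' : ∀ s p q, B p (X s * q) = B (pderiv s p) q) :
    ∀ {m : ℕ} (c : Fin m → κ), Function.Injective c → ∀ {E : Type} [Fintype E]
      (f : E → (Fin m → Fin d) → ℂ) (g : E → MvPolynomial (κ × Fin d) ℂ),
      0 ≤ (modeForm B c f g).re := by
  intro m
  induction m with
  | zero =>
    intro c _ E _ f g
    have h : modeForm B c f g = B (∑ e, conj (f e default) • g e) (∑ e, conj (f e default) • g e) := by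
      simp only [modeForm, modeMonomial, Finset.univ_unique, Finset.sum_singleton, map_sum,
        LinearMap.sum_apply, LinearMap.map_smulₛₗ, LinearMap.smul_apply, smul_eq_mul]
      refine Finset.sum_congr rfl fun e _ => ?_
      rw [Finset.mul_sum]
      refine Finset.sum_congr rfl fun e' _ => ?_
      simp [mul_assoc]
    rw [h]
    exact hpos _
  | succ m ih =>
    intro c hc E _ f g
    have hc' : Function.Injective fun k : Fin m => c k.succ :=
      hc.comp (Fin.succ_injective m)
    rw [modeForm_succ B hadj hadj' c hc, Complex.add_re, Complex.re_sum]
    exact add_nonneg (Finset.sum_nonneg fun a _ => ih _ hc' _ _) (ih _ hc' _ _)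

/-- Keeping only the contracted term in every mode produces the left side; each discarded derivative
term is nonnegative. -/
lemma le_modeForm [DecidableEq κ]
    (B : MvPolynomial (κ × Fin d) ℂ →ₗ⋆[ℂ] MvPolynomial (κ × Fin d) ℂ →ₗ[ℂ] ℂ)
    (hpos : ∀ p, 0 ≤ (B p p).re)
    (hadj : ∀ s p q, B (X s * p) q = B p (pderiv s q))
    (hadj' : ∀ s p q, B p (X s * q) = B (pderiv s p) q)
    (g : MvPolynomial (κ × Fin d) ℂ) :
    ∀ {m : ℕ} (c : Fin m → κ), Function.Injective c → ∀ (f : (Fin m → Fin d) → ℂ),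
      (∑ i, ‖f i‖ ^ 2) * (B g g).re ≤ (modeForm B c (fun _ : Unit => f) (fun _ => g)).re := by
  intro m
  induction m with
  | zero =>
    intro c _ f
    have h : modeForm B c (fun _ : Unit => f) (fun _ => g) =
        ((‖f default‖ ^ 2 : ℝ) : ℂ) * B g g := by
      simp [modeForm, modeMonomial, Complex.conj_mul']
    rw [h, Complex.re_ofReal_mul]
    simp
  | succ m ih =>
    intro c hc f
    have hc' : Function.Injective fun k : Fin m => c k.succ :=
      hc.comp (Fin.succ_injective m)
    rw [modeForm_succ B hadj hadj' c hc, Complex.add_re, Complex.re_sum, sum_fin_succ_fun,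
      Finset.sum_mul]
    exact le_add_of_le_of_nonneg (Finset.sum_le_sum fun a _ => ih _ hc' _)
      (modeForm_nonneg B hpos hadj hadj' _ hc' _ _)

/-- The multilinear form with coefficients `f`, one variable from each mode. -/
noncomputable def multilinearPoly {n : ℕ} (f : (Fin n → Fin d) → ℂ) :
    MvPolynomial (Fin n × Fin d) ℂ :=
  ∑ i, f i • modeMonomial id i

/-- Bombieri's inequality for products of multilinear forms. -/
theorem prod_le_form_prod_multilinearPoly {n : ℕ}
    (B : MvPolynomial (Fin n × Fin d) ℂ →ₗ⋆[ℂ] MvPolynomial (Fin n × Fin d) ℂ →ₗ[ℂ] ℂ)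
    (hpos : ∀ p, 0 ≤ (B p p).re) (hone : B 1 1 = 1)
    (hadj : ∀ s p q, B (X s * p) q = B p (pderiv s q))
    (hadj' : ∀ s p q, B p (X s * q) = B (pderiv s p) q)
    {τ : Type*} (s : Finset τ) (f : τ → (Fin n → Fin d) → ℂ) :
    ∏ t ∈ s, ∑ i, ‖f t i‖ ^ 2 ≤
      (B (∏ t ∈ s, multilinearPoly (f t)) (∏ t ∈ s, multilinearPoly (f t))).re := by
  classical
  induction s using Finset.induction_on with
  | empty => simp [hone]
  | insert t s ht ih =>
    rw [Finset.prod_insert ht, Finset.prod_insert ht]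
    set g := ∏ t ∈ s, multilinearPoly (f t)
    refine (mul_le_mul_of_nonneg_left ih
      (Finset.sum_nonneg fun i _ => sq_nonneg _)).trans ?_
    -- The new factor `f t` is peeled off with `g`, the product of the other forms, as a spectator.
    -- Expanding `f t * g` in both slots gives exactly the one-element `modeForm`.
    refine (le_modeForm B hpos hadj hadj' g id Function.injective_id (f t)).trans_eq ?_
    congr 1
    simp only [modeForm, multilinearPoly, Finset.univ_unique, Finset.sum_singleton, Finset.sum_mul,
      map_sum, LinearMap.sum_apply, smul_mul_assoc, LinearMap.map_smulₛₗ, LinearMap.smul_apply,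
      smul_eq_mul]
    rw [Finset.sum_comm]
    refine Finset.sum_congr rfl fun i _ => ?_
    rw [Finset.mul_sum]
    refine Finset.sum_congr rfl fun j _ => ?_
    simp only [starRingEnd_apply, RingHom.id_apply]
    ring

end Fischer

end SingleCopy

namespace SingleCopy

/-! ### The Fischer inner product and Gaussian moments -/

section Gaussian

open MvPolynomial ComplexConjugate

/-- The density of the standard complex Gaussian distribution. -/
noncomputable def gaussDensity (z : ℂ) : ℝ := Real.pi⁻¹ * Real.exp (-‖z‖ ^ 2)

lemma gaussDensity_pos (z : ℂ) : 0 < gaussDensity z := by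
  unfold gaussDensity; positivity

lemma continuous_gaussDensity : Continuous gaussDensity := by
  unfold gaussDensity; fun_prop

lemma integral_norm_pow_mul_gaussDensity (q : ℕ) :
    ∫ z : ℂ, ‖z‖ ^ q * gaussDensity z = Real.Gamma ((q : ℝ) / 2 + 1) := by
  have h := Complex.integral_rpow_mul_exp_neg_rpow (p := 2) (q := q) (by norm_num)
    (by have : (0 : ℝ) ≤ q := q.cast_nonneg
        linarith)
  have h2 : ∀ z : ℂ, ‖z‖ ^ q * gaussDensity z =
      Real.pi⁻¹ * (‖z‖ ^ (q : ℝ) * Real.exp (-‖z‖ ^ (2 : ℝ))) := by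
    intro z
    rw [Real.rpow_natCast, Real.rpow_ofNat, gaussDensity]
    ring
  simp_rw [h2]
  rw [integral_const_mul, h]
  have : Real.pi ≠ 0 := Real.pi_ne_zero
  rw [show ((q : ℝ) + 2) / 2 = (q : ℝ) / 2 + 1 by ring]
  field_simp

lemma integrable_norm_pow_mul_gaussDensity (q : ℕ) :
    Integrable fun z : ℂ => ‖z‖ ^ q * gaussDensity z := by
  -- A non-integrable function has integral `0` by convention, while the value computed above is a
  -- positive Gamma value.
  by_contra h
  have h0 := integral_undef h
  rw [integral_norm_pow_mul_gaussDensity] at h0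
  exact (Real.Gamma_pos_of_pos (by positivity)).ne' h0

lemma integral_norm_sq_pow_mul_gaussDensity (a : ℕ) :
    ∫ z : ℂ, (‖z‖ ^ 2) ^ a * gaussDensity z = (a.factorial : ℝ) := by
  simp_rw [← pow_mul]
  rw [integral_norm_pow_mul_gaussDensity]
  push_cast
  rw [mul_div_cancel_left₀ _ (two_ne_zero), Real.Gamma_nat_eq_factorial]

lemma integral_gaussDensity : ∫ z : ℂ, gaussDensity z = 1 := by
  simpa using integral_norm_sq_pow_mul_gaussDensity 0

lemma integrable_conj_pow_mul_pow (a b : ℕ) :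
    Integrable fun z : ℂ => conj z ^ a * z ^ b * (gaussDensity z : ℂ) := by
  refine (integrable_norm_pow_mul_gaussDensity (a + b)).mono' ?_ ?_
  · have := continuous_gaussDensity
    exact Continuous.aestronglyMeasurable (by fun_prop)
  · refine Filter.Eventually.of_forall fun z => ?_
    simp [abs_of_pos (gaussDensity_pos z), pow_add]

/-- The moments of the standard complex Gaussian distribution. -/
def gaussMoment (a b : ℕ) : ℂ := if a = b then (a.factorial : ℂ) else 0

/-- One-variable form of the adjointness of `z` and `d/dz`. At `b = 0` the truncated `b - 1` is
harmless, since the factor `b` vanishes. -/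
lemma gaussMoment_succ_left (a b : ℕ) :
    gaussMoment (a + 1) b = b * gaussMoment a (b - 1) := by
  cases b with
  | zero => simp [gaussMoment]
  | succ b =>
    by_cases h : a = b
    · simp [gaussMoment, h, Nat.factorial_succ]
    · simp [gaussMoment, h]

lemma integral_conj_pow_mul_pow (a b : ℕ) :
    ∫ z : ℂ, conj z ^ a * z ^ b * (gaussDensity z : ℂ) = gaussMoment a b := by
  by_cases hab : a = b
  · subst hab
    have h : ∀ z : ℂ, conj z ^ a * z ^ a * (gaussDensity z : ℂ) =
        (((‖z‖ ^ 2) ^ a * gaussDensity z : ℝ) : ℂ) := by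
      intro z
      rw [← mul_pow, Complex.conj_mul']
      push_cast
      rfl
    simp_rw [h]
    rw [integral_complex_ofReal, integral_norm_sq_pow_mul_gaussDensity]
    simp [gaussMoment]
  · rw [gaussMoment, if_neg hab]
    have hab' : (b : ℝ) - a ≠ 0 := sub_ne_zero.2 fun h => hab (by exact_mod_cast h.symm)
    -- Rotation by `θ` multiplies the integrand by `exp (i * (b - a) * θ) = -1` and preserves the
    -- measure, so the integral equals its own negative.
    set θ : ℝ := Real.pi / ((b : ℝ) - a)
    set ω : Circle := Circle.exp θ
    have hω : conj (ω : ℂ) ^ a * (ω : ℂ) ^ b = -1 := by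
      rw [Circle.coe_exp, ← Complex.exp_conj, ← Complex.exp_nat_mul, ← Complex.exp_nat_mul,
        ← Complex.exp_add, ← Complex.exp_pi_mul_I]
      congr 1
      have : ((b : ℂ) - a) ≠ 0 := by exact_mod_cast hab'
      simp only [map_mul, Complex.conj_ofReal, Complex.conj_I, θ]
      push_cast
      field_simp
      ring
    have h := (rotation ω).measurePreserving.integral_comp
      (rotation ω).toHomeomorph.measurableEmbedding
      (fun z : ℂ => conj z ^ a * z ^ b * (gaussDensity z : ℂ))
    have h2 : ∀ z : ℂ, conj (rotation ω z) ^ a * (rotation ω z) ^ b *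
        (gaussDensity (rotation ω z) : ℂ) = -(conj z ^ a * z ^ b * (gaussDensity z : ℂ)) := by
      intro z
      have hg : gaussDensity (rotation ω z) = gaussDensity z := by
        unfold gaussDensity
        rw [LinearIsometryEquiv.norm_map]
      rw [hg, rotation_apply, map_mul, mul_pow, mul_pow,
        show ∀ x y u v w : ℂ, x * y * (u * v) * w = (x * u) * (y * v * w) by intros; ring, hω]
      ring
    simp_rw [h2] at h
    rw [integral_neg] at h
    exact self_eq_neg.1 h.symm

variable {n d : ℕ}

/-- The density of `n * d` independent standard complex Gaussian variables. -/
noncomputable def gaussWeight (z : Fin n → Fin d → ℂ) : ℝ := ∏ k, ∏ i, gaussDensity (z k i)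

lemma gaussWeight_pos (z : Fin n → Fin d → ℂ) : 0 < gaussWeight z :=
  Finset.prod_pos fun _ _ => Finset.prod_pos fun _ _ => gaussDensity_pos _

lemma continuous_gaussWeight : Continuous (gaussWeight : (Fin n → Fin d → ℂ) → ℝ) := by
  have := continuous_gaussDensity
  unfold gaussWeight; fun_prop

/-- Evaluation of a polynomial in `n * d` variables. -/
noncomputable def evalModes (z : Fin n → Fin d → ℂ) : MvPolynomial (Fin n × Fin d) ℂ →+* ℂ :=
  eval fun s => z s.1 s.2

lemma evalModes_monomial (z : Fin n → Fin d → ℂ) (α : Fin n × Fin d →₀ ℕ) (a : ℂ) :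
    evalModes z (monomial α a) = a * ∏ k, ∏ i, z k i ^ α (k, i) := by
  rw [evalModes, eval_monomial, Finsupp.prod_fintype _ _ (by simp), Fintype.prod_prod_type]

lemma conj_eval_monomial_mul (z : Fin n → Fin d → ℂ) (α β : Fin n × Fin d →₀ ℕ) (a b : ℂ) :
    conj (evalModes z (monomial α a)) * evalModes z (monomial β b) * (gaussWeight z : ℂ) =
      conj a * b * ∏ k, ∏ i, (conj (z k i) ^ α (k, i) * z k i ^ β (k, i) *
        (gaussDensity (z k i) : ℂ)) := by
  simp only [evalModes_monomial, gaussWeight, Finset.prod_mul_distrib, map_mul, map_prod, map_pow,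
    Complex.ofReal_prod]
  ring

lemma integrable_conj_eval_mul (p q : MvPolynomial (Fin n × Fin d) ℂ) :
    Integrable fun z : Fin n → Fin d → ℂ =>
      conj (evalModes z p) * evalModes z q * (gaussWeight z : ℂ) := by
  induction p using MvPolynomial.induction_on' with
  | monomial α a =>
    induction q using MvPolynomial.induction_on' with
    | monomial β b =>
      simp_rw [conj_eval_monomial_mul]
      refine Integrable.const_mul ?_ _
      exact Integrable.fintype_prod fun k =>
        Integrable.fintype_prod fun i => integrable_conj_pow_mul_pow _ _
    | add p q hp hq =>
      simp_rw [map_add, mul_add, add_mul]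
      exact hp.add hq
  | add p q hp hq =>
    simp_rw [map_add, add_mul]
    exact hp.add hq

/-- The Fischer inner product on polynomials, the inner product of `L²` of the Gaussian
distribution. -/
noncomputable def fischerForm (n d : ℕ) :
    MvPolynomial (Fin n × Fin d) ℂ →ₗ⋆[ℂ] MvPolynomial (Fin n × Fin d) ℂ →ₗ[ℂ] ℂ :=
  LinearMap.mk₂'ₛₗ (starRingEnd ℂ) (RingHom.id ℂ)
    (fun p q => ∫ z : Fin n → Fin d → ℂ, conj (evalModes z p) * evalModes z q * (gaussWeight z : ℂ))
    (fun p p' q => by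
      rw [← integral_add (integrable_conj_eval_mul _ _) (integrable_conj_eval_mul _ _)]
      simp_rw [map_add, add_mul])
    (fun c p q => by
      rw [smul_eq_mul, ← integral_const_mul]
      refine integral_congr_ae (Filter.Eventually.of_forall fun z => ?_)
      simp [evalModes, smul_eval, mul_assoc])
    (fun p q q' => by
      rw [← integral_add (integrable_conj_eval_mul _ _) (integrable_conj_eval_mul _ _)]
      simp_rw [map_add, mul_add, add_mul])
    (fun c p q => by
      rw [smul_eq_mul, ← integral_const_mul]
      refine integral_congr_ae (Filter.Eventually.of_forall fun z => ?_)
      simp only [evalModes, smul_eval, RingHom.id_apply]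
      ring)

lemma fischerForm_apply (p q : MvPolynomial (Fin n × Fin d) ℂ) :
    fischerForm n d p q = ∫ z : Fin n → Fin d → ℂ,
      conj (evalModes z p) * evalModes z q * (gaussWeight z : ℂ) := rfl

lemma fischerForm_monomial (α β : Fin n × Fin d →₀ ℕ) (a b : ℂ) :
    fischerForm n d (monomial α a) (monomial β b) =
      conj a * b * ∏ s, gaussMoment (α s) (β s) := by
  rw [fischerForm_apply]
  simp_rw [conj_eval_monomial_mul]
  rw [integral_const_mul, Fintype.prod_prod_type]
  congr 1
  rw [integral_fintype_prod_volume_eq_prod (fun (k : Fin n) (z : Fin d → ℂ) =>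
    ∏ i, (conj (z i) ^ α (k, i) * z i ^ β (k, i) * (gaussDensity (z i) : ℂ)))]
  refine Finset.prod_congr rfl fun k _ => ?_
  rw [integral_fintype_prod_volume_eq_prod (fun (i : Fin d) (z : ℂ) =>
    conj z ^ α (k, i) * z ^ β (k, i) * (gaussDensity z : ℂ))]
  exact Finset.prod_congr rfl fun i _ => integral_conj_pow_mul_pow _ _

lemma fischerForm_one : fischerForm n d 1 1 = 1 := by
  have h := fischerForm_monomial (n := n) (d := d) 0 0 1 1
  simpa [gaussMoment] using h

lemma conj_fischerForm (p q : MvPolynomial (Fin n × Fin d) ℂ) :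
    conj (fischerForm n d p q) = fischerForm n d q p := by
  rw [fischerForm_apply, fischerForm_apply, ← integral_conj]
  refine integral_congr_ae (Filter.Eventually.of_forall fun z => ?_)
  simp only [map_mul, Complex.conj_conj, Complex.conj_ofReal]
  ring

lemma fischerForm_X_mul (s : Fin n × Fin d) (p q : MvPolynomial (Fin n × Fin d) ℂ) :
    fischerForm n d (X s * p) q = fischerForm n d p (pderiv s q) := by
  induction p using MvPolynomial.induction_on' with
  | monomial α a =>
    induction q using MvPolynomial.induction_on' with
    | monomial β b =>
      rw [pderiv_monomial, X, monomial_mul, one_mul, fischerForm_monomial, fischerForm_monomial,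
        ← Finset.mul_prod_erase _ _ (Finset.mem_univ s),
        ← Finset.mul_prod_erase _ (fun s' => gaussMoment (α s') _) (Finset.mem_univ s)]
      have h : ∏ x ∈ Finset.univ.erase s, gaussMoment ((Finsupp.single s 1 + α : Fin n × Fin d →₀ ℕ) x) (β x) =
          ∏ x ∈ Finset.univ.erase s, gaussMoment (α x)
            ((β - Finsupp.single s 1 : Fin n × Fin d →₀ ℕ) x) := by
        refine Finset.prod_congr rfl fun x hx => ?_
        have hx' : s ≠ x := (Finset.ne_of_mem_erase hx).symm
        simp [hx']
      rw [h]
      have h2 : gaussMoment ((Finsupp.single s 1 + α : Fin n × Fin d →₀ ℕ) s) (β s) =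
          β s * gaussMoment (α s) ((β - Finsupp.single s 1 : Fin n × Fin d →₀ ℕ) s) := by
        simp [add_comm (1 : ℕ), gaussMoment_succ_left]
      rw [h2]
      ring
    | add q q' hq hq' => rw [map_add, map_add, map_add, hq, hq']
  | add p p' hp hp' =>
    rw [mul_add, map_add, LinearMap.add_apply, hp, hp', map_add, LinearMap.add_apply]

lemma fischerForm_mul_X (s : Fin n × Fin d) (p q : MvPolynomial (Fin n × Fin d) ℂ) :
    fischerForm n d p (X s * q) = fischerForm n d (pderiv s p) q := by
  rw [← conj_fischerForm, fischerForm_X_mul, conj_fischerForm]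

lemma fischerForm_self (p : MvPolynomial (Fin n × Fin d) ℂ) :
    fischerForm n d p p =
      ((∫ z : Fin n → Fin d → ℂ, ‖evalModes z p‖ ^ 2 * gaussWeight z : ℝ) : ℂ) := by
  rw [fischerForm_apply, ← integral_complex_ofReal]
  refine integral_congr_ae (Filter.Eventually.of_forall fun z => ?_)
  simp [Complex.conj_mul']

lemma integrable_norm_sq_eval_mul (p : MvPolynomial (Fin n × Fin d) ℂ) :
    Integrable fun z : Fin n → Fin d → ℂ => ‖evalModes z p‖ ^ 2 * gaussWeight z := by
  refine (integrable_conj_eval_mul p p).norm.congr (Filter.Eventually.of_forall fun z => ?_)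
  simp [abs_of_pos (gaussWeight_pos z), sq]

lemma evalModes_multilinearPoly (z : Fin n → Fin d → ℂ) (f : (Fin n → Fin d) → ℂ) :
    evalModes z (multilinearPoly f) = ∑ i, f i * productVector z i := by
  simp [evalModes, multilinearPoly, modeMonomial, productVector, smul_eval, map_prod]

/-- Bombieri's inequality as a correlation inequality for Gaussian product vectors. -/
theorem prod_le_integral_prod_norm_sq {τ : Type*} [Fintype τ] (f : τ → (Fin n → Fin d) → ℂ) :
    ∏ t, ∑ i, ‖f t i‖ ^ 2 ≤ ∫ z : Fin n → Fin d → ℂ,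
      (∏ t, ‖∑ i, f t i * productVector z i‖ ^ 2) * gaussWeight z := by
  have h := prod_le_form_prod_multilinearPoly (fischerForm n d)
    (fun p => by
      rw [fischerForm_self, Complex.ofReal_re]
      exact integral_nonneg fun z => mul_nonneg (sq_nonneg _) (gaussWeight_pos z).le)
    fischerForm_one fischerForm_X_mul fischerForm_mul_X Finset.univ f
  rw [fischerForm_self, Complex.ofReal_re] at h
  simpa only [map_prod, evalModes_multilinearPoly, norm_prod, Finset.prod_pow] using h

lemma integrable_prod_norm_sq {τ : Type*} [Fintype τ] (f : τ → (Fin n → Fin d) → ℂ) :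
    Integrable fun z : Fin n → Fin d → ℂ =>
      (∏ t, ‖∑ i, f t i * productVector z i‖ ^ 2) * gaussWeight z := by
  have h := integrable_norm_sq_eval_mul (∏ t, multilinearPoly (f t))
  simpa only [map_prod, evalModes_multilinearPoly, norm_prod, Finset.prod_pow] using h

lemma card_piAntidiag_fin (d T : ℕ) :
    (Finset.piAntidiag (Finset.univ : Finset (Fin d)) T).card = d.multichoose T := by
  rw [← Finset.map_sym_eq_piAntidiag, Finset.card_map, Finset.sym_univ, Finset.card_univ,
    Sym.card_sym_fin_eq_multichoose]

lemma factorial_mul_multichoose {d : ℕ} (hd : 1 ≤ d) (T : ℕ) :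
    T.factorial * d.multichoose T = d.ascFactorial T := by
  obtain ⟨e, rfl⟩ := Nat.exists_eq_add_of_le' hd
  rw [Nat.multichoose_eq, Nat.ascFactorial_eq_factorial_mul_choose]
  congr 2
  omega

lemma integrable_prod_norm_sq_pow (κ : Fin d → ℕ) :
    Integrable fun z : Fin d → ℂ => ∏ i, ((‖z i‖ ^ 2) ^ κ i * gaussDensity (z i)) := by
  refine Integrable.fintype_prod (f := fun i (z : ℂ) => (‖z‖ ^ 2) ^ κ i * gaussDensity z)
    fun i => ?_
  simp_rw [← pow_mul]
  exact integrable_norm_pow_mul_gaussDensity _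

lemma sum_norm_sq_pow_mul (T : ℕ) (z : Fin d → ℂ) :
    (∑ i, ‖z i‖ ^ 2) ^ T * ∏ i, gaussDensity (z i) =
      ∑ κ ∈ Finset.piAntidiag Finset.univ T, (Nat.multinomial Finset.univ κ : ℝ) *
        ∏ i, ((‖z i‖ ^ 2) ^ κ i * gaussDensity (z i)) := by
  rw [Finset.sum_pow_eq_sum_piAntidiag, Finset.sum_mul]
  refine Finset.sum_congr rfl fun κ _ => ?_
  rw [Finset.prod_mul_distrib, mul_assoc]

/-- The even moments of the norm of a standard Gaussian vector in `ℂ^d`. -/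
lemma integral_sum_norm_sq_pow (hd : 1 ≤ d) (T : ℕ) :
    ∫ z : Fin d → ℂ, (∑ i, ‖z i‖ ^ 2) ^ T * ∏ i, gaussDensity (z i) = (d.ascFactorial T : ℝ) := by
  simp_rw [sum_norm_sq_pow_mul]
  rw [integral_finsetSum _ fun κ _ => (integrable_prod_norm_sq_pow κ).const_mul _]
  -- The multinomial coefficient cancels the factorial moments `∏ i, (κ i)!`, leaving `T!` for every
  -- exponent vector; the sum is then a count of these vectors.
  have h : ∀ κ ∈ Finset.piAntidiag (Finset.univ : Finset (Fin d)) T,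
      ∫ z : Fin d → ℂ, (Nat.multinomial Finset.univ κ : ℝ) *
        ∏ i, ((‖z i‖ ^ 2) ^ κ i * gaussDensity (z i)) = (T.factorial : ℝ) := by
    intro κ hκ
    rw [integral_const_mul, integral_fintype_prod_volume_eq_prod
      (fun (i : Fin d) (z : ℂ) => (‖z‖ ^ 2) ^ κ i * gaussDensity z)]
    simp_rw [integral_norm_sq_pow_mul_gaussDensity]
    rw [← (Finset.mem_piAntidiag.1 hκ).1, ← Nat.multinomial_spec]
    push_cast
    ring
  rw [Finset.sum_congr rfl h, Finset.sum_const, card_piAntidiag_fin, nsmul_eq_mul,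
    ← factorial_mul_multichoose hd]
  push_cast
  ring

lemma integrable_sum_norm_sq_pow (T : ℕ) :
    Integrable fun z : Fin d → ℂ => (∑ i, ‖z i‖ ^ 2) ^ T * ∏ i, gaussDensity (z i) := by
  simp_rw [sum_norm_sq_pow_mul]
  exact integrable_finsetSum _ fun κ _ => (integrable_prod_norm_sq_pow κ).const_mul _

lemma prod_pow_mul_gaussWeight (T : ℕ) (z : Fin n → Fin d → ℂ) :
    (∏ k, (∑ i, ‖z k i‖ ^ 2) ^ T) * gaussWeight z =
      ∏ k, ((∑ i, ‖z k i‖ ^ 2) ^ T * ∏ i, gaussDensity (z k i)) := by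
  rw [Finset.prod_mul_distrib]
  rfl

lemma integral_prod_sum_norm_sq_pow (hd : 1 ≤ d) (T : ℕ) :
    ∫ z : Fin n → Fin d → ℂ, (∏ k, (∑ i, ‖z k i‖ ^ 2) ^ T) * gaussWeight z =
      (d.ascFactorial T : ℝ) ^ n := by
  simp_rw [prod_pow_mul_gaussWeight]
  rw [integral_fintype_prod_volume_eq_pow
    (fun z : Fin d → ℂ => (∑ i, ‖z i‖ ^ 2) ^ T * ∏ i, gaussDensity (z i)),
    integral_sum_norm_sq_pow hd, Fintype.card_fin]

lemma integrable_prod_sum_norm_sq_pow (T : ℕ) :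
    Integrable fun z : Fin n → Fin d → ℂ =>
      (∏ k, (∑ i, ‖z k i‖ ^ 2) ^ T) * gaussWeight z := by
  simp_rw [prod_pow_mul_gaussWeight]
  exact Integrable.fintype_prod fun k => integrable_sum_norm_sq_pow T

lemma lintegral_gaussWeight :
    ∫⁻ z : Fin n → Fin d → ℂ, ENNReal.ofReal (gaussWeight z) = 1 := by
  have hi : Integrable (gaussWeight : (Fin n → Fin d → ℂ) → ℝ) := by
    simpa using integrable_prod_sum_norm_sq_pow (n := n) (d := d) 0
  rw [← ofReal_integral_eq_lintegral_ofReal hi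
    (Filter.Eventually.of_forall fun z => (gaussWeight_pos z).le)]
  have h : ∫ z : Fin n → Fin d → ℂ, gaussWeight z = 1 := by
    unfold gaussWeight
    rw [integral_fintype_prod_volume_eq_pow (fun z : Fin d → ℂ => ∏ i, gaussDensity (z i)),
      integral_fintype_prod_volume_eq_pow gaussDensity, integral_gaussDensity]
    simp
  rw [h, ENNReal.ofReal_one]

end Gaussian

end SingleCopy

namespace SingleCopy

/-! ### From Gaussian vectors to Haar-random unit vectors -/

section Haar

variable {n d : ℕ}

instance unitaryGroupSecondCountable (d : ℕ) :
    SecondCountableTopology (Matrix.unitaryGroup (Fin d) ℂ) := by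
  have : SecondCountableTopology (Matrix (Fin d) (Fin d) ℂ) :=
    inferInstanceAs (SecondCountableTopology (Fin d → Fin d → ℂ))
  exact TopologicalSpace.Subtype.secondCountableTopology _

instance haarUnitaryIsHaarMeasure (d : ℕ) : (haarUnitary d).IsHaarMeasure :=
  Measure.isHaarMeasure_haarMeasure _

/-- A right translate of the Haar measure is again a Haar probability measure, and that measure is
unique. -/
instance haarUnitaryIsMulRightInvariant (d : ℕ) : (haarUnitary d).IsMulRightInvariant where
  map_mul_right_eq_self g := by
    have : IsProbabilityMeasure ((haarUnitary d).map (· * g)) :=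
      Measure.isProbabilityMeasure_map (measurable_mul_const g).aemeasurable
    exact Measure.isHaarMeasure_eq_of_isProbabilityMeasure _ _

lemma exists_unitary_mulVec_single (i₀ : Fin d) (φ : EuclideanSpace ℂ (Fin d)) (hφ : ‖φ‖ = 1) :
    ∃ A : Matrix.unitaryGroup (Fin d) ℂ,
      (A : Matrix (Fin d) (Fin d) ℂ) *ᵥ Pi.single i₀ 1 = φ.ofLp := by
  have hv : Orthonormal ℂ (({i₀} : Set (Fin d)).domRestrict fun _ => φ) := by
    refine ⟨fun _ => hφ, fun i j hij => (hij (Subsingleton.elim _ _)).elim⟩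
  obtain ⟨b, hb⟩ := hv.exists_orthonormalBasis_extension_of_card_eq (by simp)
  refine ⟨⟨_, (EuclideanSpace.basisFun (Fin d) ℂ).toMatrix_orthonormalBasis_mem_unitary b⟩, ?_⟩
  rw [Matrix.mulVec_single_one]
  ext i
  simp [Module.Basis.toMatrix_apply, hb i₀ rfl]

/-- The unitary group acts transitively on spheres. -/
lemma exists_unitary_smul_mulVec (φ v : EuclideanSpace ℂ (Fin d)) (hφ : ‖φ‖ = 1) :
    ∃ V : Matrix.unitaryGroup (Fin d) ℂ,
      v.ofLp = (‖v‖ : ℂ) • ((V : Matrix (Fin d) (Fin d) ℂ) *ᵥ φ.ofLp) := by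
  by_cases hv : v = 0
  · subst hv
    exact ⟨1, by simp⟩
  · have hv' : ‖v‖ ≠ 0 := norm_ne_zero_iff.2 hv
    have hv'' : (‖v‖ : ℂ) ≠ 0 := by exact_mod_cast hv'
    have hne : Nonempty (Fin d) := by
      by_contra h
      rw [not_nonempty_iff] at h
      exact hv (Subsingleton.elim _ _)
    obtain ⟨i₀⟩ := hne
    obtain ⟨A, hA⟩ := exists_unitary_mulVec_single i₀ φ hφ
    obtain ⟨A', hA'⟩ := exists_unitary_mulVec_single i₀ ((‖v‖ : ℂ)⁻¹ • v) (by
      rw [norm_smul, norm_inv, Complex.norm_real, norm_norm, inv_mul_cancel₀ hv'])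
    refine ⟨A' * A⁻¹, ?_⟩
    rw [← hA, Matrix.mulVec_mulVec, ← Submonoid.coe_mul, inv_mul_cancel_right, hA',
      WithLp.ofLp_smul, smul_smul, mul_inv_cancel₀ hv'', one_smul]

/-- Local unitaries applied to an `n`-tuple of vectors. -/
def rotateModes (U : Fin n → Matrix.unitaryGroup (Fin d) ℂ) (z : Fin n → Fin d → ℂ) :
    Fin n → Fin d → ℂ :=
  fun k => (U k : Matrix (Fin d) (Fin d) ℂ) *ᵥ z k

lemma rotateModes_mul (U V : Fin n → Matrix.unitaryGroup (Fin d) ℂ) (z : Fin n → Fin d → ℂ) :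
    rotateModes (U * V) z = rotateModes U (rotateModes V z) := by
  funext k
  simp [rotateModes, Matrix.mulVec_mulVec]

lemma continuous_rotateModes :
    Continuous fun p : (Fin n → Matrix.unitaryGroup (Fin d) ℂ) × (Fin n → Fin d → ℂ) =>
      rotateModes p.1 p.2 := by
  refine continuous_pi fun k => ?_
  exact Continuous.matrix_mulVec
    (continuous_subtype_val.comp ((continuous_apply k).comp continuous_fst))
    ((continuous_apply k).comp continuous_snd)

lemma sum_norm_sq_unitary_mulVec (U : Matrix.unitaryGroup (Fin d) ℂ) (v : Fin d → ℂ) :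
    ∑ i, ‖((U : Matrix (Fin d) (Fin d) ℂ) *ᵥ v) i‖ ^ 2 = ∑ i, ‖v i‖ ^ 2 := by
  have h : ∀ w : Fin d → ℂ, ((∑ i, ‖w i‖ ^ 2 : ℝ) : ℂ) = star w ⬝ᵥ w := by
    intro w
    simp [dotProduct, Complex.conj_mul']
  have h2 : ((∑ i, ‖((U : Matrix (Fin d) (Fin d) ℂ) *ᵥ v) i‖ ^ 2 : ℝ) : ℂ) =
      ((∑ i, ‖v i‖ ^ 2 : ℝ) : ℂ) := by
    rw [h, h, Matrix.star_mulVec, Matrix.dotProduct_mulVec, Matrix.vecMul_vecMul,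
      ← Matrix.star_eq_conjTranspose, Unitary.coe_star_mul_self, Matrix.vecMul_one]
  exact_mod_cast h2

lemma gaussWeight_eq (z : Fin n → Fin d → ℂ) :
    gaussWeight z = ∏ k, ((Real.pi⁻¹) ^ d * Real.exp (-∑ i, ‖z k i‖ ^ 2)) := by
  simp only [gaussWeight, gaussDensity, Finset.prod_mul_distrib, ← Real.exp_sum,
    Finset.sum_neg_distrib, Finset.prod_const, Finset.card_univ, Fintype.card_fin]

lemma gaussWeight_rotateModes (U : Fin n → Matrix.unitaryGroup (Fin d) ℂ)
    (z : Fin n → Fin d → ℂ) : gaussWeight (rotateModes U z) = gaussWeight z := by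
  simp only [gaussWeight_eq, rotateModes, sum_norm_sq_unitary_mulVec]

/-- `rotateModes U` as a linear equivalence. -/
def rotateModesEquiv (U : Fin n → Matrix.unitaryGroup (Fin d) ℂ) :
    (Fin n → Fin d → ℂ) ≃ₗ[ℝ] (Fin n → Fin d → ℂ) where
  toFun := rotateModes U
  invFun := rotateModes U⁻¹
  map_add' x y := by
    funext k
    simp [rotateModes, Matrix.mulVec_add]
  map_smul' c x := by
    funext k
    simp [rotateModes, Matrix.mulVec_smul]
  left_inv x := by
    rw [← rotateModes_mul, inv_mul_cancel]
    funext k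
    simp [rotateModes]
  right_inv x := by
    rw [← rotateModes_mul, mul_inv_cancel]
    funext k
    simp [rotateModes]

instance volumeModesIsAddHaarMeasure :
    (volume : Measure (Fin n → Fin d → ℂ)).IsAddHaarMeasure := by
  have : (volume : Measure (Fin d → ℂ)).IsAddHaarMeasure :=
    inferInstanceAs (Measure.pi fun _ : Fin d => (volume : Measure ℂ)).IsAddHaarMeasure
  exact Measure.pi.isAddHaarMeasure _

/-- Local unitaries preserve the Gaussian distribution. -/
lemma lintegral_comp_rotateModes (U : Fin n → Matrix.unitaryGroup (Fin d) ℂ)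
    (F : (Fin n → Fin d → ℂ) → ENNReal) (hF : Measurable F) :
    ∫⁻ z, F (rotateModes U z) * ENNReal.ofReal (gaussWeight z) =
      ∫⁻ z, F z * ENNReal.ofReal (gaussWeight z) := by
  have hU : Measurable (rotateModes (n := n) U) :=
    (continuous_rotateModes.comp (by fun_prop : Continuous fun z => (U, z))).measurable
  have hW : Measurable fun z : Fin n → Fin d → ℂ => ENNReal.ofReal (gaussWeight z) :=
    (continuous_gaussWeight.measurable).ennreal_ofReal
  have hdet : LinearMap.det (rotateModesEquiv U : (Fin n → Fin d → ℂ) →ₗ[ℝ] _) ≠ 0 :=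
    (LinearEquiv.isUnit_det' _).ne_zero
  have hmap := Measure.map_linearMap_addHaar_eq_smul_addHaar
    (volume : Measure (Fin n → Fin d → ℂ)) hdet
  set c := ENNReal.ofReal
    |(LinearMap.det (rotateModesEquiv U : (Fin n → Fin d → ℂ) →ₗ[ℝ] _))⁻¹|
  have hmap' : Measure.map (rotateModes U) (volume : Measure (Fin n → Fin d → ℂ)) =
    c • volume := hmap
  have key : ∀ G : (Fin n → Fin d → ℂ) → ENNReal, Measurable G →
      ∫⁻ z, G (rotateModes U z) * ENNReal.ofReal (gaussWeight z) =
        c * ∫⁻ z, G z * ENNReal.ofReal (gaussWeight z) := by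
    intro G hG
    rw [← smul_eq_mul, ← lintegral_smul_measure, ← hmap',
      lintegral_map (f := fun z => G z * ENNReal.ofReal (gaussWeight z)) (hG.mul hW) hU]
    simp_rw [gaussWeight_rotateModes]
  -- The Jacobian needs no determinant computation: testing on the constant `1`, whose Gaussian
  -- integral is `1`, forces the scaling factor to be `1`.
  have hc : c = 1 := by
    have h1 := key (fun _ => 1) measurable_const
    simpa [lintegral_gaussWeight] using h1.symm
  rw [key F hF, hc, one_mul]

/-- A homogeneous function of independent Gaussian vectors is, on average, a multiple of its
average over products of Haar-random unit vectors. -/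
theorem integral_mul_gaussWeight_eq (hd : 1 ≤ d) (T : ℕ) (φ : EuclideanSpace ℂ (Fin d))
    (hφ : ‖φ‖ = 1) (F : (Fin n → Fin d → ℂ) → ℝ) (hF : Continuous F) (hF0 : ∀ z, 0 ≤ F z)
    (hint : Integrable fun z => F z * gaussWeight z)
    (hhom : ∀ (r : Fin n → ℝ) (z : Fin n → Fin d → ℂ),
      F (fun k => (r k : ℂ) • z k) = (∏ k, (r k ^ 2) ^ T) * F z) :
    ∫ z, F z * gaussWeight z = (d.ascFactorial T : ℝ) ^ n *
      ∫ U : Fin n → Matrix.unitaryGroup (Fin d) ℂ, F (rotateModes U fun _ => φ.ofLp)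
        ∂(Measure.pi fun _ => haarUnitary d) := by
  set μ : Measure (Fin n → Matrix.unitaryGroup (Fin d) ℂ) := Measure.pi fun _ => haarUnitary d
  have hFm : Measurable fun z => ENNReal.ofReal (F z) := hF.measurable.ennreal_ofReal
  have hW : Measurable fun z : Fin n → Fin d → ℂ => ENNReal.ofReal (gaussWeight z) :=
    (continuous_gaussWeight.measurable).ennreal_ofReal
  have hU : Continuous fun U : Fin n → Matrix.unitaryGroup (Fin d) ℂ =>
      F (rotateModes U fun _ => φ.ofLp) :=
    hF.comp (continuous_rotateModes.comp (by fun_prop :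
      Continuous fun U : Fin n → Matrix.unitaryGroup (Fin d) ℂ => (U, fun _ : Fin n => φ.ofLp)))
  have hUint : Integrable (fun U : Fin n → Matrix.unitaryGroup (Fin d) ℂ =>
      F (rotateModes U fun _ => φ.ofLp)) μ :=
    hU.integrable_of_hasCompactSupport (HasCompactSupport.of_compactSpace _)
  set I := ∫⁻ U, ENNReal.ofReal (F (rotateModes U fun _ => φ.ofLp)) ∂μ
  -- Polar decomposition `z k = ‖z k‖ • V k φ`: homogeneity extracts the norms and right invariance
  -- of Haar measure absorbs `V`.
  have hinner : ∀ z : Fin n → Fin d → ℂ, ∫⁻ U, ENNReal.ofReal (F (rotateModes U z)) ∂μ =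
      ENNReal.ofReal (∏ k, (∑ i, ‖z k i‖ ^ 2) ^ T) * I := by
    intro z
    choose V hV using fun k => exists_unitary_smul_mulVec φ (WithLp.toLp 2 (z k)) hφ
    have h1 : ∀ U, F (rotateModes U z) = (∏ k, (∑ i, ‖z k i‖ ^ 2) ^ T) *
        F (rotateModes (U * V) fun _ => φ.ofLp) := by
      intro U
      have h2 : rotateModes U z =
          fun k => ((‖WithLp.toLp 2 (z k)‖ : ℝ) : ℂ) •
            rotateModes (U * V) (fun _ => φ.ofLp) k := by
        rw [rotateModes_mul]
        funext k
        change (U k : Matrix (Fin d) (Fin d) ℂ) *ᵥ z k = _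
        conv_lhs => rw [show z k = _ from hV k]
        rw [Matrix.mulVec_smul]
        rfl
      rw [h2, hhom]
      simp_rw [EuclideanSpace.norm_sq_eq]
    simp_rw [h1, ENNReal.ofReal_mul (Finset.prod_nonneg fun k _ =>
      pow_nonneg (Finset.sum_nonneg fun i _ => sq_nonneg ‖z k i‖) T)]
    rw [lintegral_const_mul']
    · congr 1
      exact lintegral_mul_right_eq_self
        (fun U => ENNReal.ofReal (F (rotateModes U fun _ => φ.ofLp))) V
    · exact ENNReal.ofReal_ne_top
  -- A dummy average over `U` is inserted by Gaussian invariance; Tonelli then lets the `U`-integral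
  -- be done first, leaving only the radial moments.
  have hswap : ∫⁻ z, ENNReal.ofReal (F z) * ENNReal.ofReal (gaussWeight z) =
      ENNReal.ofReal ((d.ascFactorial T : ℝ) ^ n) * I := by
    calc ∫⁻ z, ENNReal.ofReal (F z) * ENNReal.ofReal (gaussWeight z)
        = ∫⁻ _U, (∫⁻ z, ENNReal.ofReal (F z) * ENNReal.ofReal (gaussWeight z)) ∂μ := by simp
      _ = ∫⁻ U, (∫⁻ z, ENNReal.ofReal (F (rotateModes U z)) * ENNReal.ofReal (gaussWeight z)) ∂μ :=
          lintegral_congr fun U => (lintegral_comp_rotateModes U _ hFm).symm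
      _ = ∫⁻ z, (∫⁻ U, ENNReal.ofReal (F (rotateModes U z)) *
            ENNReal.ofReal (gaussWeight z) ∂μ) := by
          refine lintegral_lintegral_swap (Measurable.aemeasurable ?_)
          exact ((hF.comp continuous_rotateModes).measurable.ennreal_ofReal).mul
            (hW.comp measurable_snd)
      _ = ∫⁻ z, ENNReal.ofReal ((∏ k, (∑ i, ‖z k i‖ ^ 2) ^ T) * gaussWeight z) * I := by
          refine lintegral_congr fun z => ?_
          rw [lintegral_mul_const' _ _ ENNReal.ofReal_ne_top, hinner,
            ENNReal.ofReal_mul (Finset.prod_nonneg fun k _ =>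
              pow_nonneg (Finset.sum_nonneg fun i _ => sq_nonneg ‖z k i‖) T)]
          ring
      _ = ENNReal.ofReal ((d.ascFactorial T : ℝ) ^ n) * I := by
          have hm : Measurable fun z : Fin n → Fin d → ℂ =>
              ENNReal.ofReal ((∏ k, (∑ i, ‖z k i‖ ^ 2) ^ T) * gaussWeight z) := by
            have := continuous_gaussWeight (n := n) (d := d)
            exact (Continuous.measurable (by fun_prop)).ennreal_ofReal
          rw [lintegral_mul_const _ hm, ← ofReal_integral_eq_lintegral_ofReal
            (integrable_prod_sum_norm_sq_pow T) (Filter.Eventually.of_forall fun z =>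
              mul_nonneg (Finset.prod_nonneg fun k _ =>
                pow_nonneg (Finset.sum_nonneg fun i _ => sq_nonneg ‖z k i‖) T)
                (gaussWeight_pos z).le), integral_prod_sum_norm_sq_pow hd]
  have hI : I = ENNReal.ofReal (∫ U, F (rotateModes U fun _ => φ.ofLp) ∂μ) :=
    (ofReal_integral_eq_lintegral_ofReal hUint
      (Filter.Eventually.of_forall fun U => hF0 _)).symm
  have hL : ENNReal.ofReal (∫ z, F z * gaussWeight z) =
      ∫⁻ z, ENNReal.ofReal (F z) * ENNReal.ofReal (gaussWeight z) := by
    rw [ofReal_integral_eq_lintegral_ofReal hint (Filter.Eventually.of_forall fun z =>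
      mul_nonneg (hF0 z) (gaussWeight_pos z).le)]
    exact lintegral_congr fun z => ENNReal.ofReal_mul (hF0 z)
  rw [hswap, hI, ← ENNReal.ofReal_mul (by positivity)] at hL
  exact (ENNReal.ofReal_eq_ofReal_iff
    (integral_nonneg fun z => mul_nonneg (hF0 z) (gaussWeight_pos z).le)
    (mul_nonneg (by positivity) (integral_nonneg fun U => hF0 _))).1 hL

end Haar

end SingleCopy

namespace SingleCopy

/-! ### The pointwise likelihood-ratio bound -/

section LikelihoodRatio

variable {n d : ℕ}

lemma trace_pureDensity_mul_sum {ι : Type*} [Fintype ι] {m : ℕ} (v : Fin m → ι → ℂ) (ψ : ι → ℂ) :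
    (Matrix.trace (pureDensity ψ * ∑ r, Matrix.vecMulVec (v r) (star (v r)))).re =
      ∑ r, ‖∑ i, star (v r i) * ψ i‖ ^ 2 := by
  have h : ∀ r, Matrix.trace (pureDensity ψ * Matrix.vecMulVec (v r) (star (v r))) =
      ((‖∑ i, star (v r i) * ψ i‖ ^ 2 : ℝ) : ℂ) := by
    intro r
    rw [pureDensity, Matrix.vecMulVec_mul_vecMulVec, Matrix.trace_vecMulVec, dotProduct_smul]
    push_cast
    rw [← Complex.conj_mul', smul_eq_mul]
    congr 1
    · simp [dotProduct, mul_comm]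
    · simp [dotProduct, mul_comm]
  rw [Matrix.mul_sum, Matrix.trace_sum, Complex.re_sum]
  simp_rw [h, Complex.ofReal_re]

lemma trace_sum_vecMulVec {ι : Type*} [Fintype ι] {m : ℕ} (v : Fin m → ι → ℂ) :
    (Matrix.trace (∑ r, Matrix.vecMulVec (v r) (star (v r)))).re =
      ∑ r, ∑ i, ‖star (v r i)‖ ^ 2 := by
  rw [Matrix.trace_sum, Complex.re_sum]
  refine Finset.sum_congr rfl fun r _ => ?_
  rw [Matrix.trace_vecMulVec, dotProduct, Complex.re_sum]
  refine Finset.sum_congr rfl fun i _ => ?_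
  rw [Pi.star_apply, Complex.star_def, Complex.mul_conj', ← Complex.ofReal_pow, Complex.ofReal_re,
    RCLike.norm_conj]

lemma productVector_smul (r : Fin n → ℝ) (z : Fin n → Fin d → ℂ) (i : Fin n → Fin d) :
    productVector (fun k => (r k : ℂ) • z k) i = (∏ k, (r k : ℂ)) * productVector z i := by
  simp [productVector, Finset.prod_mul_distrib]

lemma continuous_productVector (i : Fin n → Fin d) :
    Continuous fun z : Fin n → Fin d → ℂ => productVector z i := by
  unfold productVector
  fun_prop

/-- The probability of a string of outcomes on copies of a Haar-random product state is, up to a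
factor, at least its probability on copies of the maximally mixed state. -/
theorem prod_trace_le_integral (hd : 1 ≤ d) {T : ℕ} (φ : EuclideanSpace ℂ (Fin d)) (hφ : ‖φ‖ = 1)
    (M : Fin T → Matrix (Fin n → Fin d) (Fin n → Fin d) ℂ) (hM : ∀ t, (M t).PosSemidef) :
    ∏ t, (Matrix.trace (M t)).re ≤ (d.ascFactorial T : ℝ) ^ n *
      ∫ U : Fin n → Matrix.unitaryGroup (Fin d) ℂ,
        ∏ t, (Matrix.trace (rotatedProductState φ U * M t)).re
        ∂(Measure.pi fun _ => haarUnitary d) := by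
  choose m v hv using fun t => Matrix.posSemidef_iff_eq_sum_vecMulVec.1 (hM t)
  set F : (Fin n → Fin d → ℂ) → ℝ := fun z =>
    ∏ t, ∑ r, ‖∑ i, star (v t r i) * productVector z i‖ ^ 2
  have hFU : ∀ U : Fin n → Matrix.unitaryGroup (Fin d) ℂ,
      ∏ t, (Matrix.trace (rotatedProductState φ U * M t)).re =
        F (rotateModes U fun _ => φ.ofLp) := by
    intro U
    refine Finset.prod_congr rfl fun t _ => ?_
    rw [hv t, rotatedProductState, trace_pureDensity_mul_sum]
    rfl
  -- Expanding the product over all choices of one rank-one term per effect makes every summand a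
  -- product of squared multilinear forms, to which Bombieri's inequality applies separately.
  have hFsum : ∀ z, F z * gaussWeight z =
      ∑ r ∈ Fintype.piFinset fun t => (Finset.univ : Finset (Fin (m t))),
        (∏ t, ‖∑ i, star (v t (r t) i) * productVector z i‖ ^ 2) * gaussWeight z := by
    intro z
    rw [← Finset.sum_mul]
    exact congrArg (· * gaussWeight z) (Finset.prod_univ_sum _ _)
  have hFc : Continuous F := by
    have := continuous_productVector (n := n) (d := d)
    fun_prop
  have hint : Integrable fun z => F z * gaussWeight z := by
    simp_rw [hFsum]
    exact integrable_finsetSum _ fun r _ =>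
      integrable_prod_norm_sq fun t i => star (v t (r t) i)
  have hhom : ∀ (r : Fin n → ℝ) (z : Fin n → Fin d → ℂ),
      F (fun k => (r k : ℂ) • z k) = (∏ k, (r k ^ 2) ^ T) * F z := by
    intro r z
    have h1 : ∀ w : (Fin n → Fin d) → ℂ,
        ‖∑ i, w i * productVector (fun k => (r k : ℂ) • z k) i‖ ^ 2 =
          (∏ k, r k ^ 2) * ‖∑ i, w i * productVector z i‖ ^ 2 := by
      intro w
      simp_rw [productVector_smul, mul_left_comm (w _)]
      rw [← Finset.mul_sum, norm_mul, mul_pow, norm_prod, ← Finset.prod_pow]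
      simp
    simp only [F, h1, ← Finset.mul_sum, Finset.prod_mul_distrib, Finset.prod_const,
      Finset.card_univ, Fintype.card_fin, Finset.prod_pow]
  simp_rw [hFU]
  rw [← integral_mul_gaussWeight_eq hd T φ hφ F hFc
    (fun z => Finset.prod_nonneg fun t _ => Finset.sum_nonneg fun r _ => sq_nonneg _) hint hhom]
  simp_rw [hFsum]
  rw [integral_finsetSum _ fun r _ => integrable_prod_norm_sq fun t i => star (v t (r t) i)]
  have htr : ∀ t, (Matrix.trace (M t)).re = ∑ r, ∑ i, ‖star (v t r i)‖ ^ 2 := by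
    intro t
    conv_lhs => rw [hv t]
    exact trace_sum_vecMulVec _
  simp_rw [htr]
  rw [Finset.prod_univ_sum]
  exact Finset.sum_le_sum fun r _ => prod_le_integral_prod_norm_sq fun t i => star (v t (r t) i)

/-- Each of the `T` factors of `d.ascFactorial T` is at most `d + T`, so the right side is at least
`(1 - T / (d + T)) ^ (T * n)`; Bernoulli's inequality bounds this below. -/
lemma one_sub_le_div_pow (n : ℕ) {d : ℕ} (hd : 1 ≤ d) (T : ℕ) :
    1 - (n : ℝ) * (T : ℝ) ^ 2 / d ≤ ((d : ℝ) ^ T / (d.ascFactorial T : ℝ)) ^ n := by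
  have hd0 : (0 : ℝ) < d := by exact_mod_cast hd
  have hT0 : (0 : ℝ) ≤ T := T.cast_nonneg
  have hn0 : (0 : ℝ) ≤ n := n.cast_nonneg
  have hasc : (d.ascFactorial T : ℝ) ≤ ((d : ℝ) + T) ^ T := by
    obtain ⟨e, rfl⟩ := Nat.exists_eq_add_of_le' hd
    have h := (Nat.ascFactorial_le_pow_add e T).trans
      (Nat.pow_le_pow_left (show e + T ≤ e + 1 + T by omega) T)
    exact_mod_cast h
  have hasc0 : (0 : ℝ) < d.ascFactorial T := by
    obtain ⟨e, rfl⟩ := Nat.exists_eq_add_of_le' hd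
    exact_mod_cast Nat.ascFactorial_pos e T
  have hfrac : (T : ℝ) / (d + T) ≤ 1 := by
    rw [div_le_one (by positivity)]
    linarith
  calc 1 - (n : ℝ) * (T : ℝ) ^ 2 / d ≤ 1 + ((T * n : ℕ) : ℝ) * (-((T : ℝ) / (d + T))) := by
        have h1 : (n : ℝ) * (T : ℝ) ^ 2 / (d + T) ≤ (n : ℝ) * (T : ℝ) ^ 2 / d :=
          div_le_div_of_nonneg_left (by positivity) hd0 (by linarith)
        have h2 : 1 + ((T * n : ℕ) : ℝ) * (-((T : ℝ) / (d + T))) =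
            1 - (n : ℝ) * (T : ℝ) ^ 2 / (d + T) := by
          push_cast
          ring
        linarith
    _ ≤ (1 + -((T : ℝ) / (d + T))) ^ (T * n) := one_add_mul_le_pow (by linarith) _
    _ = ((d : ℝ) ^ T / ((d : ℝ) + T) ^ T) ^ n := by
        rw [pow_mul, ← div_pow]
        congr 2
        field_simp
        ring
    _ ≤ ((d : ℝ) ^ T / (d.ascFactorial T : ℝ)) ^ n := by
        gcongr

end LikelihoodRatio

/-! ### Adaptive outcome distributions and testing -/

section Probability

/-- An adaptive sequence of probability distributions induces one on strings of outcomes. -/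
lemma hasSum_adaptive_prod {K : Type*} :
    ∀ {T : ℕ} (q : (t : Fin T) → (Fin (t : ℕ) → K) → K → ℝ), (∀ t h k, 0 ≤ q t h k) →
      (∀ t h, HasSum (q t h) 1) →
      HasSum (fun l : Fin T → K => ∏ t, q t (fun s => l (Fin.castLE t.isLt.le s)) (l t)) 1 := by
  intro T
  induction T with
  | zero =>
    intro q _ _
    simp
  | succ T ih =>
    intro q hq0 hq
    obtain ⟨h₀⟩ : Nonempty (Fin ((0 : Fin (T + 1)) : ℕ) → K) := ⟨fun s => absurd s.isLt (by simp)⟩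
    -- The first outcome `k` is split off: `Q k` is the law of the remaining outcomes given `k`,
    -- itself adaptive with histories prefixed by `k`.
    set Q : K → (Fin T → K) → ℝ := fun k l =>
      ∏ t : Fin T, q t.succ (Fin.cons k fun s => l (Fin.castLE t.isLt.le s)) (l t)
    have hQ : ∀ k, HasSum (Q k) 1 := fun k =>
      ih (fun t h => q t.succ (Fin.cons k h)) (fun _ _ _ => hq0 _ _ _) fun _ _ => hq _ _
    have hfib : ∀ k, HasSum (fun l => q 0 h₀ k * Q k l) (q 0 h₀ k) := fun k => by
      simpa using (hQ k).mul_left (q 0 h₀ k)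
    have hs : Summable fun p : K × (Fin T → K) => q 0 h₀ p.1 * Q p.1 p.2 := by
      refine (summable_prod_of_nonneg fun p => mul_nonneg (hq0 _ _ _)
        (Finset.prod_nonneg fun t _ => hq0 _ _ _)).2 ⟨fun k => (hfib k).summable, ?_⟩
      exact (hq 0 h₀).summable.congr fun k => (hfib k).tsum_eq.symm
    have hsum : HasSum (fun p : K × (Fin T → K) => q 0 h₀ p.1 * Q p.1 p.2) 1 := by
      have h := hs.hasSum
      rwa [(h.prod_fiberwise hfib).unique (hq 0 h₀)] at h
    rw [← (Fin.consEquiv fun _ : Fin (T + 1) => K).hasSum_iff]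
    convert hsum using 1
    funext p
    rw [Function.comp_apply, Fin.prod_univ_succ]
    congr 1
    · congr 1
      funext s
      exact absurd s.isLt (by simp)
    · refine Finset.prod_congr rfl fun t _ => ?_
      congr 1
      funext s
      refine Fin.cases ?_ (fun s => ?_) s
      · rfl
      · rfl

/-- A one-sided bound on the likelihood ratio bounds the bias of every test. -/
lemma abs_tsum_sub_tsum_le {α : Type*} {p₀ p₁ w : α → ℝ} {r : ℝ} (hw0 : ∀ a, 0 ≤ w a)
    (hw1 : ∀ a, w a ≤ 1) (h0 : ∀ a, 0 ≤ p₀ a) (h1 : ∀ a, 0 ≤ p₁ a) (hp₀ : HasSum p₀ 1)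
    (hp₁ : ∀ s : Finset α, ∑ a ∈ s, p₁ a ≤ 1) (hr1 : r ≤ 1) (hr : ∀ a, r * p₀ a ≤ p₁ a) :
    |∑' a, w a * p₁ a - ∑' a, w a * p₀ a| ≤ 1 - r := by
  have s1 : Summable p₁ := summable_of_sum_le h1 hp₁
  have t1 : ∑' a, p₁ a ≤ 1 := s1.tsum_le_of_sum_le hp₁
  have sw0 : Summable fun a => w a * p₀ a :=
    hp₀.summable.of_nonneg_of_le (fun a => mul_nonneg (hw0 a) (h0 a))
      fun a => mul_le_of_le_one_left (h0 a) (hw1 a)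
  have sw1 : Summable fun a => w a * p₁ a :=
    s1.of_nonneg_of_le (fun a => mul_nonneg (hw0 a) (h1 a))
      fun a => mul_le_of_le_one_left (h1 a) (hw1 a)
  have a0 : 0 ≤ ∑' a, w a * p₀ a := tsum_nonneg fun a => mul_nonneg (hw0 a) (h0 a)
  have a1 : ∑' a, w a * p₀ a ≤ 1 := by
    rw [← hp₀.tsum_eq]
    exact sw0.tsum_le_tsum (fun a => mul_le_of_le_one_left (h0 a) (hw1 a)) hp₀.summable
  have lower : r * ∑' a, w a * p₀ a ≤ ∑' a, w a * p₁ a := by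
    rw [← tsum_mul_left]
    refine (sw0.mul_left r).tsum_le_tsum (fun a => ?_) sw1
    rw [mul_left_comm]
    exact mul_le_mul_of_nonneg_left (hr a) (hw0 a)
  -- The excess `p₁ - r * p₀` is nonnegative with total mass at most `1 - r`, so weighting by `w ≤
  -- 1` cannot exceed that mass.
  have upper : ∑' a, w a * p₁ a - r * ∑' a, w a * p₀ a ≤ ∑' a, p₁ a - r := by
    have hsub : HasSum (fun a => p₁ a - r * p₀ a) (∑' a, p₁ a - r) := by
      simpa using s1.hasSum.sub (hp₀.mul_left r)
    refine hasSum_le (fun a => ?_) (sw1.hasSum.sub (sw0.hasSum.mul_left r)) hsub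
    have := mul_le_of_le_one_left (sub_nonneg.2 (hr a)) (hw1 a)
    linarith
  have h2 : (1 - r) * ∑' a, w a * p₀ a ≤ 1 - r :=
    mul_le_of_le_one_right (by linarith) a1
  have h3 : 0 ≤ (1 - r) * ∑' a, w a * p₀ a := mul_nonneg (by linarith) a0
  rw [abs_le]
  constructor <;> nlinarith

end Probability

/-! ### Application to single-copy algorithms -/

namespace Algorithm

variable {n d T : ℕ} {K : Type u}

lemma hasSum_outcomeProb (A : Algorithm n d T K)
    (ρ : Matrix (Fin n → Fin d) (Fin n → Fin d) ℂ)
    (hρ : ∀ M : Matrix (Fin n → Fin d) (Fin n → Fin d) ℂ, M.PosSemidef →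
      0 ≤ (Matrix.trace (ρ * M)).re)
    (htr : (Matrix.trace ρ).re = 1) : HasSum (A.outcomeProb ρ) 1 := by
  refine hasSum_adaptive_prod
    (fun t h k => (Matrix.trace (ρ * (A.measurement t h).effect k)).re)
    (fun t h k => hρ _ ((A.measurement t h).posSemidef k)) fun t h => ?_
  let L : Matrix (Fin n → Fin d) (Fin n → Fin d) ℂ →+ ℝ :=
    Complex.reAddGroupHom.comp ((Matrix.traceAddMonoidHom _ ℂ).comp (AddMonoidHom.mulLeft ρ))
  have hL : Continuous L := by
    have : Continuous fun M : Matrix (Fin n → Fin d) (Fin n → Fin d) ℂ =>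
        (Matrix.trace (ρ * M)).re :=
      Complex.continuous_re.comp (Continuous.matrix_trace (continuous_const.mul continuous_id))
    exact this
  have h := (A.measurement t h).hasSum_one.map L hL
  have h1 : L 1 = 1 := by
    change (Matrix.trace (ρ * 1)).re = 1
    rw [mul_one, htr]
  rw [h1] at h
  exact h

lemma trace_maximallyMixed_mul (M : Matrix (Fin n → Fin d) (Fin n → Fin d) ℂ) :
    (Matrix.trace (maximallyMixed n d * M)).re = ((d : ℝ) ^ n)⁻¹ * (Matrix.trace M).re := by
  rw [maximallyMixed, smul_mul_assoc, one_mul, Matrix.trace_smul, smul_eq_mul,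
    ← Complex.re_ofReal_mul]
  push_cast
  rfl

lemma trace_re_nonneg {M : Matrix (Fin n → Fin d) (Fin n → Fin d) ℂ} (hM : M.PosSemidef) :
    0 ≤ (Matrix.trace M).re :=
  (Complex.le_def.1 hM.trace_nonneg).1

lemma trace_pureDensity_mul_nonneg {M : Matrix (Fin n → Fin d) (Fin n → Fin d) ℂ}
    (hM : M.PosSemidef) (ψ : (Fin n → Fin d) → ℂ) :
    0 ≤ (Matrix.trace (pureDensity ψ * M)).re := by
  obtain ⟨m, v, rfl⟩ := Matrix.posSemidef_iff_eq_sum_vecMulVec.1 hM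
  rw [trace_pureDensity_mul_sum]
  exact Finset.sum_nonneg fun r _ => sq_nonneg _

lemma hasSum_mixedOutcomeProb (hd : 1 ≤ d) (A : Algorithm n d T K) :
    HasSum A.mixedOutcomeProb 1 := by
  have hd0 : (0 : ℝ) < d := by exact_mod_cast hd
  refine A.hasSum_outcomeProb _ (fun M hM => ?_) ?_
  · rw [trace_maximallyMixed_mul]
    exact mul_nonneg (by positivity) (trace_re_nonneg hM)
  · rw [← mul_one (maximallyMixed n d), trace_maximallyMixed_mul, Matrix.trace_one,
      Complex.natCast_re]
    simp [hd0.ne']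

lemma trace_pureDensity_productVector (z : Fin n → Fin d → ℂ) :
    (Matrix.trace (pureDensity (productVector z))).re = ∏ k, ∑ i, ‖z k i‖ ^ 2 := by
  rw [pureDensity, Matrix.trace_vecMulVec, dotProduct, Complex.re_sum, Finset.prod_univ_sum,
    Fintype.piFinset_univ]
  refine Finset.sum_congr rfl fun i _ => ?_
  rw [Pi.star_apply, Complex.star_def, Complex.mul_conj', ← Complex.ofReal_pow, Complex.ofReal_re,
    productVector, norm_prod, Finset.prod_pow]

lemma hasSum_rotatedOutcomeProb (A : Algorithm n d T K) (φ : EuclideanSpace ℂ (Fin d))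
    (hφ : ‖φ‖ = 1) (U : Fin n → Matrix.unitaryGroup (Fin d) ℂ) :
    HasSum (A.outcomeProb (rotatedProductState φ U)) 1 := by
  refine A.hasSum_outcomeProb _ (fun M hM => trace_pureDensity_mul_nonneg hM _) ?_
  rw [rotatedProductState, trace_pureDensity_productVector]
  simp_rw [sum_norm_sq_unitary_mulVec, ← EuclideanSpace.norm_sq_eq φ, hφ]
  simp

lemma outcomeProb_rotated_nonneg (A : Algorithm n d T K) (φ : EuclideanSpace ℂ (Fin d))
    (U : Fin n → Matrix.unitaryGroup (Fin d) ℂ) (l : Fin T → K) :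
    0 ≤ A.outcomeProb (rotatedProductState φ U) l :=
  Finset.prod_nonneg fun t _ =>
    trace_pureDensity_mul_nonneg ((A.measurement t _).posSemidef _) _

lemma continuous_outcomeProb_rotated (A : Algorithm n d T K) (φ : EuclideanSpace ℂ (Fin d))
    (l : Fin T → K) :
    Continuous fun U : Fin n → Matrix.unitaryGroup (Fin d) ℂ =>
      A.outcomeProb (rotatedProductState φ U) l := by
  have hz : Continuous fun U : Fin n → Matrix.unitaryGroup (Fin d) ℂ =>
      productVector (rotateModes U fun _ => φ.ofLp) :=
    (continuous_pi continuous_productVector).comp (continuous_rotateModes.comp (by fun_prop :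
      Continuous fun U : Fin n → Matrix.unitaryGroup (Fin d) ℂ => (U, fun _ : Fin n => φ.ofLp)))
  have hρ : Continuous fun U : Fin n → Matrix.unitaryGroup (Fin d) ℂ => rotatedProductState φ U :=
    Continuous.matrix_vecMulVec hz hz.star
  unfold outcomeProb
  exact continuous_finsetProd _ fun t _ => Complex.continuous_re.comp
    (Continuous.matrix_trace (hρ.mul continuous_const))

/-- Finite partial sums suffice for the testing bound, so no infinite sum over the possibly
uncountable `K` has to be exchanged with the Haar integral. -/
lemma sum_haarProductOutcomeProb_le (A : Algorithm n d T K) (φ : EuclideanSpace ℂ (Fin d))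
    (hφ : ‖φ‖ = 1) (s : Finset (Fin T → K)) :
    ∑ l ∈ s, A.haarProductOutcomeProb φ l ≤ 1 := by
  have hint : ∀ l, Integrable (fun U : Fin n → Matrix.unitaryGroup (Fin d) ℂ =>
      A.outcomeProb (rotatedProductState φ U) l) (Measure.pi fun _ => haarUnitary d) := fun l =>
    (A.continuous_outcomeProb_rotated φ l).integrable_of_hasCompactSupport
      (HasCompactSupport.of_compactSpace _)
  unfold haarProductOutcomeProb
  rw [← integral_finsetSum _ fun l _ => hint l]
  calc _ ≤ ∫ _U : Fin n → Matrix.unitaryGroup (Fin d) ℂ, (1 : ℝ)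
        ∂(Measure.pi fun _ => haarUnitary d) := by
        refine integral_mono (integrable_finsetSum _ fun l _ => hint l) (integrable_const _)
          fun U => ?_
        exact sum_le_hasSum s (fun l _ => A.outcomeProb_rotated_nonneg φ U l)
          (A.hasSum_rotatedOutcomeProb φ hφ U)
    _ = 1 := by simp

/-- The mixed state gives probability `d ^ (-n * T) * ∏ t, tr (M t)`; the power of `d` cancels the
numerator of the ratio, leaving `prod_trace_le_integral`. -/
lemma mul_mixedOutcomeProb_le (hd : 1 ≤ d) (A : Algorithm n d T K)
    (φ : EuclideanSpace ℂ (Fin d)) (hφ : ‖φ‖ = 1) (l : Fin T → K) :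
    ((d : ℝ) ^ T / (d.ascFactorial T : ℝ)) ^ n * A.mixedOutcomeProb l ≤
      A.haarProductOutcomeProb φ l := by
  have hd0 : (0 : ℝ) < d := by exact_mod_cast hd
  have hasc0 : (0 : ℝ) < d.ascFactorial T := by
    obtain ⟨e, rfl⟩ := Nat.exists_eq_add_of_le' hd
    exact_mod_cast Nat.ascFactorial_pos e T
  have h := prod_trace_le_integral hd φ hφ
    (fun t => (A.measurement t fun s => l (Fin.castLE t.isLt.le s)).effect (l t))
    fun t => (A.measurement t _).posSemidef _
  have h2 : A.mixedOutcomeProb l = (((d : ℝ) ^ n)⁻¹) ^ T * ∏ t : Fin T, (Matrix.trace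
      ((A.measurement t fun s => l (Fin.castLE t.isLt.le s)).effect (l t))).re := by
    unfold mixedOutcomeProb outcomeProb
    simp_rw [trace_maximallyMixed_mul]
    rw [Finset.prod_mul_distrib, Finset.prod_const, Finset.card_univ, Fintype.card_fin]
  change _ ≤ (d.ascFactorial T : ℝ) ^ n * A.haarProductOutcomeProb φ l at h
  rw [h2, div_pow, ← pow_mul, inv_pow, ← pow_mul, mul_comm n T, ← mul_assoc,
    div_mul_eq_mul_div, mul_inv_cancel₀ (by positivity), one_div, inv_mul_le_iff₀ (by positivity)]
  exact h

theorem bias_le (A : Algorithm n d T K) (φ : EuclideanSpace ℂ (Fin d)) (hφ : ‖φ‖ = 1) :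
    A.bias φ ≤ (n : ℝ) * (T : ℝ) ^ 2 / d := by
  have hd : 1 ≤ d := by
    by_contra h
    obtain rfl : d = 0 := by omega
    rw [Subsingleton.elim φ 0, norm_zero] at hφ
    exact zero_ne_one hφ
  have hd0 : (0 : ℝ) < d := by exact_mod_cast hd
  have hasc0 : (0 : ℝ) < d.ascFactorial T := by
    obtain ⟨e, rfl⟩ := Nat.exists_eq_add_of_le' hd
    exact_mod_cast Nat.ascFactorial_pos e T
  have hasc : (d : ℝ) ^ T ≤ d.ascFactorial T := by
    exact_mod_cast Nat.pow_succ_le_ascFactorial d T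
  have h0 : ∀ l, 0 ≤ A.mixedOutcomeProb l := fun l => by
    unfold mixedOutcomeProb outcomeProb
    refine Finset.prod_nonneg fun t _ => ?_
    rw [trace_maximallyMixed_mul]
    exact mul_nonneg (by positivity) (trace_re_nonneg ((A.measurement t _).posSemidef _))
  have h1 : ∀ l, 0 ≤ A.haarProductOutcomeProb φ l := fun l =>
    integral_nonneg fun U => A.outcomeProb_rotated_nonneg φ U l
  have h := abs_tsum_sub_tsum_le (p₀ := A.mixedOutcomeProb) (p₁ := A.haarProductOutcomeProb φ)
    (w := A.decision) (r := ((d : ℝ) ^ T / (d.ascFactorial T : ℝ)) ^ n)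
    A.decision_nonneg A.decision_le_one h0 h1
    (A.hasSum_mixedOutcomeProb hd) (A.sum_haarProductOutcomeProb_le φ hφ)
    (pow_le_one₀ (by positivity) ((div_le_one hasc0).2 hasc))
    (A.mul_mixedOutcomeProb_le hd φ hφ)
  have h2 := one_sub_le_div_pow n hd T
  unfold bias acceptProb
  linarith

end Algorithm

end SingleCopy

/-! ### The two bounds with explicit constants -/

theorem proposition10 :
    (∃ c : ℝ, 0 < c ∧
      ∀ (n d T : ℕ) (K : Type u) (A : SingleCopy.Algorithm n d T K)
        (φ : EuclideanSpace ℂ (Fin d)), 1 ≤ n → ‖φ‖ = 1 →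
        2 / 3 ≤ A.successProb φ → c * Real.sqrt ((d : ℝ) / (n : ℝ)) ≤ (T : ℝ)) ∧
    (∃ C : ℝ, 0 < C ∧
      ∀ (n d T : ℕ) (K : Type u) (A : SingleCopy.Algorithm n d T K)
        (φ : EuclideanSpace ℂ (Fin d)), 1 ≤ n → ‖φ‖ = 1 →
        A.bias φ ≤ C * ((n : ℝ) * (T : ℝ) ^ 2 / (d : ℝ))) := by
  -- Success probability `2/3` means bias at least `1/3`, hence `d ≤ 3 * n * T ^ 2 ≤ n * (2 * T) ^
  -- 2`; this gives `c = 1/2`.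
  refine ⟨⟨1 / 2, by norm_num, fun n d T K A φ hn hφ hs => ?_⟩,
    1, one_pos, fun n d T K A φ _ hφ => by rw [one_mul]; exact A.bias_le φ hφ⟩
  have hb := A.bias_le φ hφ
  have hn0 : (0 : ℝ) < n := by exact_mod_cast hn
  have h1 : 1 / 3 ≤ (n : ℝ) * (T : ℝ) ^ 2 / d := by
    refine le_trans ?_ hb
    unfold SingleCopy.Algorithm.successProb at hs
    refine le_trans ?_ (le_abs_self _)
    linarith
  have hd0 : (0 : ℝ) < d := by
    rcases (Nat.cast_nonneg d : (0 : ℝ) ≤ d).eq_or_lt with h | h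
    · rw [← h, div_zero] at h1
      norm_num at h1
    · exact h
  rw [le_div_iff₀ hd0] at h1
  have h2 : Real.sqrt ((d : ℝ) / n) ≤ 2 * T := by
    refine Real.sqrt_le_iff.2 ⟨by positivity, ?_⟩
    rw [div_le_iff₀ hn0]
    nlinarith [mul_nonneg hn0.le (sq_nonneg (T : ℝ))]
  linarith
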